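/- Let $k$ be a commutative ring. Let $k\mathcal C$ be the category whose objects are the finite sets and in which the morphisms from $X$ to $Y$ form the free $k$-module $k\mathcal C(Y,X)$ on the set $\mathcal C(Y,X)$ of all correspondences $S\subseteq Y\times X$, composed $k$-bilinearly by $RS=\{(z,x)\mid \exists y,\ (z,y)\in R,\ (y,x)\in S\}$; write $\Delta_E$ for the identity relation. A correspondence functor is a $k$-linear functor $k\mathcal C\to k\text{-Mod}$; a morphism of such functors is a natural transformation, and it is surjective if all its components are. For a finite set $E$, let $\mathcal P_E$ be the quotient of the algebra $k\mathcal C(E,E)$ by the two-sided ideal generated by all relations that factor through a set of cardinality smaller than $|E|$ and by all differences $S-\overline S$, where $S$ is a reflexive relation and $\overline S$ its transitive closure. For a partial order $R$ on $E$ put $f_R=\sum_{S\supseteq R}\mu(R,S)\,S\in\mathcal P_E$, where $S$ runs over the partial orders on $E$ containing $R$ and $\mu$ is the Möbius function of the poset of partial orders on $E$ ordered by inclusion. Let $W=\mathcal P_Ef_R$ be the left ideal generated by $f_R$, viewed as a $k\mathcal C(E,E)$-module. Let $L_{E,W}=k\mathcal C(-,E)\otimes_{k\mathcal C(E,E)}W$,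 let $J_{E,W}$ be its subfunctor $$J_{E,W}(X)=\Big\{\sum_i\varphi_i\otimes w_i\ \Big|\ \sum_i(\psi\varphi_i)\cdot w_i=0\ \text{ for all }\psi\in k\mathcal C(E,X)\Big\},$$ and let $\mathbb S_{E,R}=L_{E,W}/J_{E,W}$. One has $\mathbb S_{E,R}(E)\cong\mathcal P_Ef_R$, where $w\in\mathcal P_Ef_R$ corresponds to the class of $\Delta_E\otimes w$. Let $T$ be a finite (nonempty) lattice. Let $F_T$ be the correspondence functor whose value at $X$ is the free $k$-module with basis the set of all maps $X\to T$, a correspondence $S\subseteq Y\times X$ acting by $(S\varphi)(y)=\bigvee_{(y,x)\in S}\varphi(x)$. Let $E$ be the set of join-irreducible elements of $T$ (the least element is not irreducible), $R$ the restriction to $E$ of the order of $T$, $R^{op}$ the opposite order, and $\iota:E\to T$ the inclusion. Let $H_T$ be the subfunctor of $F_T$ such that $H_T(X)$ is spanned by the maps $\varphi:X\to T$ with $E\not\subseteq\varphi(X)$. **Theorem.** (a) There is a unique morphism of correspondence functors $\Theta_T:F_T\to\mathbb S_{E,R^{op}}$ mapping $\iota\in F_T(E)$ to $f_{R^{op}}\in\mathbb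 S_{E,R^{op}}(E)\cong\mathcal P_Ef_{R^{op}}$. Moreover, $\Theta_T$ is surjective. (b) The subfunctor $H_T$ is contained in the kernel of $\Theta_T$. In particular, $\Theta_T$ factors uniquely through the quotient $F_T\to F_T/H_T$, and the induced morphism $\overline\Theta_T:F_T/H_T\to\mathbb S_{E,R^{op}}$ is surjective. -/

import Mathlib

open CategoryTheory TensorProduct

universe u v w

/-! ### Finite sets and correspondences -/

/-- The objects of the category of finite sets and correspondences: the finite sets. -/
structure FinCorr : Type (u + 1) where
  /-- The underlying set. -/
  carrier : Type u
  /-- The underlying set is finite. -/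
  [finite : Finite carrier]

namespace FinCorr

instance : CoeSort FinCorr.{u} (Type u) := ⟨carrier⟩

attribute [instance] FinCorr.finite

/-- Morphisms from `X` to `Y` are the correspondences, i.e. the subsets of `Y × X`; the composite
of `R : X ⟶ Y` and `S : Y ⟶ Z` is `S R = {(z, x) | ∃ y, (z, y) ∈ S ∧ (y, x) ∈ R}`. -/
instance : Category FinCorr.{u} where
  Hom X Y := SetRel Y X
  id _ := SetRel.id
  comp R S := SetRel.comp S R
  id_comp R := SetRel.comp_id R
  comp_id R := SetRel.id_comp R
  assoc R S T := (SetRel.comp_assoc T S R).symm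

end FinCorr

/-- The `k`-linearization `k𝒞` of the category of finite sets and correspondences. -/
abbrev LinCorr (k : Type v) : Type (u + 1) := Free k FinCorr.{u}

/-- The finite set underlying an object of `k𝒞` (the objects of `k𝒞` are the finite sets). -/
def LinCorr.toFin {k : Type v} (X : LinCorr.{u} k) : FinCorr.{u} := X

section

variable (k : Type v) [CommRing k]

/-- A correspondence `R ⊆ Y × X`, as a basis element of the free module `k𝒞(Y, X)` of morphisms
from `X` to `Y`. -/
noncomputable def relHom {X Y : FinCorr.{u}} (R : SetRel Y X) :
    (Free.of k X : LinCorr.{u} k) ⟶ Free.of k Y :=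
  (Free.embedding k FinCorr.{u}).map R

theorem relHom_id (X : FinCorr.{u}) :
    relHom k (SetRel.id : SetRel X X) = 𝟙 (Free.of k X : LinCorr.{u} k) := rfl

theorem relHom_comp {X Y Z : FinCorr.{u}} (R : SetRel Y X) (S : SetRel Z Y) :
    relHom k R ≫ relHom k S = relHom k (SetRel.comp S R) :=
  ((Free.embedding k FinCorr.{u}).map_comp (X := X) (Y := Y) (Z := Z) R S).symm

/-- Induction on morphisms of `k𝒞`: they are linear combinations of correspondences. -/
theorem LinCorr.hom_induction {X Y : FinCorr.{u}}
    {P : ((Free.of k X : LinCorr.{u} k) ⟶ Free.of k Y) → Prop}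
    (f : (Free.of k X : LinCorr.{u} k) ⟶ Free.of k Y)
    (zero : P 0) (add : ∀ f g, P f → P g → P (f + g))
    (smul : ∀ (c : k) (R : SetRel Y X), P (c • relHom k R)) : P f := by
  refine Finsupp.induction_linear (motive := P) f zero add (fun R c => ?_)
  have h : (c • relHom k (X := X) (Y := Y) R) = (Finsupp.single R c : _ →₀ k) := by
    change c • (Finsupp.single R 1 : _ →₀ k) = _
    rw [Finsupp.smul_single, smul_eq_mul, mul_one]
  exact Eq.mp (congrArg P h) (smul c R)

end

/-! ### Correspondence functors

A correspondence functor is a `k`-linear functor `LinCorr k ⥤ ModuleCat k`; a morphism of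
correspondence functors is a natural transformation. -/

section Subfunctors

variable {k : Type v} [CommRing k]

/-- A subfunctor of a functor from `k𝒞` to `k`-modules. -/
@[ext]
structure CorrSubfunctor (M : LinCorr.{u} k ⥤ ModuleCat.{w} k) where
  /-- The evaluation of the subfunctor. -/
  obj : ∀ X : LinCorr.{u} k, Submodule k (M.obj X)
  /-- The evaluations are stable under the action of morphisms. -/
  map_le : ∀ {X Y : LinCorr.{u} k} (f : X ⟶ Y), obj X ≤ (obj Y).comap (M.map f).hom

namespace CorrSubfunctor

variable {M M' : LinCorr.{u} k ⥤ ModuleCat.{w} k}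

instance : LE (CorrSubfunctor M) := ⟨fun N N' => ∀ X, N.obj X ≤ N'.obj X⟩

/-- The kernel of a morphism of functors. -/
def ker (θ : M ⟶ M') : CorrSubfunctor M where
  obj X := LinearMap.ker (θ.app X).hom
  map_le {X Y} f := by
    intro m hm
    rw [Submodule.mem_comap, LinearMap.mem_ker]
    rw [LinearMap.mem_ker] at hm
    have h := congrArg (fun g => g.hom m) (θ.naturality f)
    simp only [ModuleCat.hom_comp, LinearMap.comp_apply] at h
    rw [h, hm, map_zero]

/-- The quotient functor `M / N`. -/
noncomputable def quotient (N : CorrSubfunctor M) : LinCorr.{u} k ⥤ ModuleCat.{w} k where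
  obj X := ModuleCat.of k (M.obj X ⧸ N.obj X)
  map {X Y} f := ModuleCat.ofHom ((N.obj X).mapQ (N.obj Y) (M.map f).hom (N.map_le f))
  map_id X := by
    ext m
    simp
  map_comp f g := by
    ext m
    simp

/-- The canonical projection `M ⟶ M / N`. -/
noncomputable def proj (N : CorrSubfunctor M) : M ⟶ N.quotient where
  app X := ModuleCat.ofHom (N.obj X).mkQ
  naturality X Y f := by
    ext m
    rfl

instance (N : CorrSubfunctor M) [M.Additive] : N.quotient.Additive where
  map_add {X Y f g} := by
    refine ModuleCat.hom_ext (Submodule.linearMap_qext _ (LinearMap.ext fun m => ?_))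
    change (N.obj Y).mkQ ((M.map (f + g)).hom m) =
      (N.obj Y).mkQ ((M.map f).hom m) + (N.obj Y).mkQ ((M.map g).hom m)
    rw [M.map_add, ← map_add]
    rfl

instance (N : CorrSubfunctor M) [M.Linear k] : N.quotient.Linear k where
  map_smul {X Y} f c := by
    refine ModuleCat.hom_ext (Submodule.linearMap_qext _ (LinearMap.ext fun m => ?_))
    change (N.obj Y).mkQ ((M.map (c • f)).hom m) = c • (N.obj Y).mkQ ((M.map f).hom m)
    rw [M.map_smul, ← map_smul]
    rfl

end CorrSubfunctor

end Subfunctors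

/-! ### The functors `L_{E,W}`, `J_{E,W}` and `L_{E,W} / J_{E,W}`

The algebra `k𝒞(E, E)` is `End (Free.of k E)`, in which `a * b` is the composite `b ≫ a`. -/

section LFunctor

variable (k : Type v) [CommRing k] (E : FinCorr.{u})

/-- The algebra `k𝒞(E, E)` of all relations on `E`. -/
abbrev RelAlg : Type (max u v) := End (Free.of k E : LinCorr.{u} k)

variable (W : Type (max u v)) [AddCommGroup W] [Module k W]

variable {k} in
/-- The functoriality of `k𝒞(X, E) ⊗[k] W` in `X`. -/
noncomputable def tensorMap {X Y : LinCorr.{u} k} (g : X ⟶ Y) :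
    ((Free.of k E ⟶ X) ⊗[k] W) →ₗ[k] ((Free.of k E ⟶ Y) ⊗[k] W) :=
  LinearMap.rTensor W (Linear.rightComp k (Free.of k E) g)

variable {k} in
theorem tensorMap_tmul {X Y : LinCorr.{u} k} (g : X ⟶ Y) (φ : Free.of k E ⟶ X) (x : W) :
    tensorMap E W g (φ ⊗ₜ x) = (φ ≫ g) ⊗ₜ x := rfl

variable [Module (RelAlg k E) W]

/-- The submodule of `k𝒞(X, E) ⊗[k] W` spanned by the elements `φ a ⊗ w - φ ⊗ a w`, for
`a ∈ k𝒞(E, E)`. -/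
noncomputable def balancedRel (X : LinCorr.{u} k) :
    Submodule k ((Free.of k E ⟶ X) ⊗[k] W) :=
  Submodule.span k {t | ∃ (φ : Free.of k E ⟶ X) (a : RelAlg k E) (x : W),
    t = (a.asHom ≫ φ) ⊗ₜ[k] x - φ ⊗ₜ[k] (a • x)}

variable {k} in
theorem balancedRel_le {X Y : LinCorr.{u} k} (g : X ⟶ Y) :
    balancedRel k E W X ≤ (balancedRel k E W Y).comap (tensorMap E W g) := by
  refine Submodule.span_le.2 ?_
  rintro _ ⟨φ, a, x, rfl⟩
  refine Submodule.subset_span ⟨φ ≫ g, a, x, ?_⟩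
  rw [map_sub, tensorMap_tmul, tensorMap_tmul, Category.assoc]

/-- The functor `L_{E,W} = k𝒞(-, E) ⊗_{k𝒞(E, E)} W`. The tensor product over the noncommutative
algebra `k𝒞(E, E)` is the quotient of the tensor product over `k` by `balancedRel`. -/
noncomputable def LFunctor : LinCorr.{u} k ⥤ ModuleCat.{max u v} k where
  obj X := ModuleCat.of k (((Free.of k E ⟶ X) ⊗[k] W) ⧸ balancedRel k E W X)
  map {X Y} g := ModuleCat.ofHom
    ((balancedRel k E W X).mapQ (balancedRel k E W Y) (tensorMap E W g) (balancedRel_le E W g))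
  map_id X := by
    refine ModuleCat.hom_ext (Submodule.linearMap_qext _ (TensorProduct.ext' fun φ x => ?_))
    change (balancedRel k E W X).mkQ ((φ ≫ 𝟙 X) ⊗ₜ x) = (balancedRel k E W X).mkQ (φ ⊗ₜ x)
    rw [Category.comp_id]
  map_comp {X Y Z} f g := by
    refine ModuleCat.hom_ext (Submodule.linearMap_qext _ (TensorProduct.ext' fun φ x => ?_))
    change (balancedRel k E W Z).mkQ ((φ ≫ f ≫ g) ⊗ₜ x) =
      (balancedRel k E W Z).mkQ (((φ ≫ f) ≫ g) ⊗ₜ x)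
    rw [Category.assoc]

variable {k} in
/-- The element `φ ⊗ x` of `L_{E,W}(X)`. -/
noncomputable def ltmul {X : LinCorr.{u} k} (φ : Free.of k E ⟶ X) (x : W) :
    (LFunctor k E W).obj X :=
  (balancedRel k E W X).mkQ (φ ⊗ₜ[k] x)

variable {k} in
theorem ltmul_comp {X : LinCorr.{u} k} (φ : Free.of k E ⟶ X) (a : RelAlg k E) (x : W) :
    ltmul E W (a.asHom ≫ φ) x = ltmul E W φ (a • x) := by
  refine (Submodule.Quotient.eq _).2 (Submodule.subset_span ⟨φ, a, x, rfl⟩)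

variable {k} in
theorem LFunctor_map_ltmul {X Y : LinCorr.{u} k} (g : X ⟶ Y) (φ : Free.of k E ⟶ X) (x : W) :
    ((LFunctor k E W).map g).hom (ltmul E W φ x) = ltmul E W (φ ≫ g) x := rfl

variable {k E W} in
theorem LFunctor_hom_ext {X : LinCorr.{u} k} {N : Type*} [AddCommGroup N] [Module k N]
    {f g : (LFunctor k E W).obj X →ₗ[k] N}
    (h : ∀ φ x, f (ltmul E W φ x) = g (ltmul E W φ x)) : f = g :=
  Submodule.linearMap_qext _ (TensorProduct.ext' fun φ x => h φ x)

instance : (LFunctor k E W).Additive where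
  map_add {X Y f g} := by
    refine ModuleCat.hom_ext (LFunctor_hom_ext fun φ x => ?_)
    change (balancedRel k E W Y).mkQ ((φ ≫ (f + g)) ⊗ₜ x) =
      (balancedRel k E W Y).mkQ ((φ ≫ f) ⊗ₜ x) + (balancedRel k E W Y).mkQ ((φ ≫ g) ⊗ₜ x)
    rw [Preadditive.comp_add, TensorProduct.add_tmul, map_add]

instance : (LFunctor k E W).Linear k where
  map_smul {X Y} f c := by
    refine ModuleCat.hom_ext (LFunctor_hom_ext fun φ x => ?_)
    change (balancedRel k E W Y).mkQ ((φ ≫ (c • f)) ⊗ₜ x) =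
      c • (balancedRel k E W Y).mkQ ((φ ≫ f) ⊗ₜ x)
    rw [Linear.comp_smul, ← map_smul, TensorProduct.smul_tmul']

variable [IsScalarTower k (RelAlg k E) W]

variable {k} in
/-- For `ψ ∈ k𝒞(E, X)`, the linear map `L_{E,W}(X) → W` with `φ ⊗ x ↦ (ψ φ) x`. -/
noncomputable def LPairing {X : LinCorr.{u} k} (ψ : X ⟶ Free.of k E) :
    (LFunctor k E W).obj X →ₗ[k] W :=
  (balancedRel k E W X).liftQ
    (TensorProduct.lift ((Algebra.lsmul k k W : RelAlg k E →ₐ[k] Module.End k W).toLinearMap ∘ₗ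
      (Linear.rightComp k (Free.of k E) ψ :
        (Free.of k E ⟶ X) →ₗ[k] RelAlg k E))) (by
    refine Submodule.span_le.2 ?_
    rintro _ ⟨φ, a, x, rfl⟩
    change TensorProduct.lift _ _ = 0
    rw [map_sub, TensorProduct.lift.tmul, TensorProduct.lift.tmul, sub_eq_zero]
    change End.of ((a.asHom ≫ φ) ≫ ψ) • x = End.of (φ ≫ ψ) • (a • x)
    rw [Category.assoc, ← mul_smul]
    rfl)

variable {k} in
theorem LPairing_ltmul {X : LinCorr.{u} k} (ψ : X ⟶ Free.of k E) (φ : Free.of k E ⟶ X) (x : W) :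
    LPairing E W ψ (ltmul E W φ x) = End.of (φ ≫ ψ) • x := rfl

/-- The subfunctor `J_{E,W}` of `L_{E,W}`: the elements `∑ φᵢ ⊗ xᵢ` of `L_{E,W}(X)` such that
`∑ (ψ φᵢ) xᵢ = 0` for all `ψ ∈ k𝒞(E, X)`. -/
noncomputable def JSubfunctor : CorrSubfunctor (LFunctor k E W) where
  obj X := ⨅ ψ : X ⟶ Free.of k E, LinearMap.ker (LPairing E W ψ)
  map_le {X Y} f := by
    intro m hm
    simp only [Submodule.mem_comap, Submodule.mem_iInf, LinearMap.mem_ker] at hm ⊢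
    intro ψ
    have h : LPairing E W ψ ∘ₗ ((LFunctor k E W).map f).hom = LPairing E W (f ≫ ψ) := by
      refine LFunctor_hom_ext fun φ x => ?_
      rw [LinearMap.comp_apply, LFunctor_map_ltmul, LPairing_ltmul, LPairing_ltmul,
        Category.assoc]
    rw [← LinearMap.comp_apply, h]
    exact hm _

/-- The functor `L_{E,W} / J_{E,W}`. -/
noncomputable def LJQuotient : LinCorr.{u} k ⥤ ModuleCat.{max u v} k :=
  (JSubfunctor k E W).quotient

noncomputable instance : (LJQuotient k E W).Additive :=
  inferInstanceAs (JSubfunctor k E W).quotient.Additive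

noncomputable instance : (LJQuotient k E W).Linear k :=
  inferInstanceAs ((JSubfunctor k E W).quotient.Linear k)

/-- The canonical isomorphism `W ≅ (L_{E,W} / J_{E,W})(E)`, sending `x` to the class of
`Δ_E ⊗ x`; its inverse sends the class of `φ ⊗ x` to `φ x`. -/
noncomputable def evalEquiv : W ≃ₗ[k] (LJQuotient k E W).obj (Free.of k E) :=
  LinearEquiv.ofLinearMap
    (((JSubfunctor k E W).obj (Free.of k E)).mkQ ∘ₗ (balancedRel k E W (Free.of k E)).mkQ ∘ₗ
      TensorProduct.mk k (Free.of k E ⟶ Free.of k E) W (𝟙 (Free.of k E)))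
    (((JSubfunctor k E W).obj (Free.of k E)).liftQ (LPairing E W (𝟙 (Free.of k E))) (iInf_le _ _))
    (by
      refine Submodule.linearMap_qext _ (LFunctor_hom_ext fun φ x => ?_)
      change ((JSubfunctor k E W).obj (Free.of k E)).mkQ
        (ltmul E W (𝟙 (Free.of k E)) (LPairing E W (𝟙 (Free.of k E)) (ltmul E W φ x))) =
          ((JSubfunctor k E W).obj (Free.of k E)).mkQ (ltmul E W φ x)
      rw [LPairing_ltmul, ← ltmul_comp, Category.comp_id, Category.comp_id])
    (by
      refine LinearMap.ext fun x => ?_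
      change LPairing E W (𝟙 (Free.of k E)) (ltmul E W (𝟙 (Free.of k E)) x) = x
      rw [LPairing_ltmul, Category.comp_id]
      exact one_smul (RelAlg k E) x)

theorem evalEquiv_smul (a : RelAlg k E) (x : W) :
    evalEquiv k E W (a • x) = ((LJQuotient k E W).map a.asHom).hom (evalEquiv k E W x) := by
  change ((JSubfunctor k E W).obj _).mkQ (ltmul E W (𝟙 (Free.of k E)) (a • x)) =
    ((JSubfunctor k E W).obj _).mkQ (ltmul E W (𝟙 (Free.of k E) ≫ a.asHom) x)
  rw [← ltmul_comp, Category.comp_id, Category.id_comp]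

end LFunctor

/-! ### Orders, the algebra of permuted orders, and the fundamental functors -/

section Fundamental

/-- The (partial) orders on a set, as relations, ordered by inclusion. -/
def OrderOn (E : Type u) : Type u :=
  {R : SetRel E E // (∀ a, (a, a) ∈ R) ∧ (∀ a b, (a, b) ∈ R → (b, a) ∈ R → a = b) ∧
    ∀ a b c, (a, b) ∈ R → (b, c) ∈ R → (a, c) ∈ R}

namespace OrderOn

variable {E : Type u}

instance : PartialOrder (OrderOn E) := Subtype.partialOrder _

instance [Finite E] : Finite (OrderOn E) := Subtype.finite

/-- The opposite order. -/
def op (R : OrderOn E) : OrderOn E :=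
  ⟨R.1.inv, fun a => R.2.1 a, fun a b h h' => R.2.2.1 a b h' h,
    fun a b c h h' => R.2.2.2 c b a h' h⟩

noncomputable instance [Finite E] : Fintype (OrderOn E) := Fintype.ofFinite _

open Classical in
noncomputable instance [Finite E] : LocallyFiniteOrder (OrderOn E) :=
  Fintype.toLocallyFiniteOrder

open Classical in
/-- The Möbius function of the poset of orders on `E`, ordered by inclusion. -/
noncomputable def moebius [Finite E] (R S : OrderOn E) : ℤ := IncidenceAlgebra.mu ℤ R S

end OrderOn

/-- The transitive closure of a relation. -/
def SetRel.transClosure {E : Type u} (S : SetRel E E) : SetRel E E :=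
  {p | Relation.TransGen (fun a b => (a, b) ∈ S) p.1 p.2}

/-- A relation on `E` is inessential if it factors through a set of smaller cardinality. -/
def Inessential {E : FinCorr.{u}} (Q : SetRel E E) : Prop :=
  ∃ (Y : FinCorr.{u}) (A : SetRel E Y) (B : SetRel Y E),
    Nat.card Y < Nat.card E ∧ Q = SetRel.comp A B

variable (k : Type v) [CommRing k] (E : FinCorr.{u})

/-- The relations that define the algebra of permuted orders as a quotient of `k𝒞(E, E)`:
inessential relations become zero, which gives the essential algebra, and every reflexive relation
is identified with its transitive closure. -/
inductive PermutedOrderRel : RelAlg k E → RelAlg k E → Prop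
  | inessential (Q : SetRel E E) : Inessential Q → PermutedOrderRel (End.of (relHom k Q)) 0
  | closure (S : SetRel E E) : (∀ a, (a, a) ∈ S) →
      PermutedOrderRel (End.of (relHom k S)) (End.of (relHom k S.transClosure))

/-- The algebra `𝒫_E` of permuted orders. -/
def PermutedOrderAlg : Type (max u v) := RingQuot (PermutedOrderRel k E)

namespace PermutedOrderAlg

noncomputable instance : Ring (PermutedOrderAlg k E) :=
  inferInstanceAs (Ring (RingQuot (PermutedOrderRel k E)))

noncomputable instance : Algebra k (PermutedOrderAlg k E) :=
  inferInstanceAs (Algebra k (RingQuot (PermutedOrderRel k E)))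

/-- The quotient map `k𝒞(E, E) → 𝒫_E`. -/
noncomputable def mk : RelAlg k E →ₐ[k] PermutedOrderAlg k E :=
  RingQuot.mkAlgHom k (PermutedOrderRel k E)

noncomputable instance : Module (RelAlg k E) (PermutedOrderAlg k E) :=
  Module.compHom _ (mk k E).toRingHom

theorem smul_def (a : RelAlg k E) (p : PermutedOrderAlg k E) : a • p = mk k E a * p := rfl

instance : IsScalarTower k (RelAlg k E) (PermutedOrderAlg k E) where
  smul_assoc c a p := by rw [smul_def, smul_def, map_smul, smul_mul_assoc]

instance : IsScalarTower (RelAlg k E) (PermutedOrderAlg k E) (PermutedOrderAlg k E) where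
  smul_assoc a p q := by simp only [smul_def, smul_eq_mul, mul_assoc]

end PermutedOrderAlg

/-- The idempotent `f_R = ∑_{S ⊇ R} μ(R, S) S` of `𝒫_E`, where `S` runs over the orders
containing `R`; equivalently, the `f_S` are the elements with `R = ∑_{S ⊇ R} f_S` for all `R`. -/
noncomputable def orderIdem (R : OrderOn E) : PermutedOrderAlg k E :=
  ∑ S : OrderOn E, R.moebius S • PermutedOrderAlg.mk k E (End.of (relHom k S.1))

/-- The fundamental module `𝒫_E f_R`: the left ideal of `𝒫_E` generated by `f_R`. -/
noncomputable abbrev FundamentalModule (R : OrderOn E) : Type (max u v) :=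
  ↥(Ideal.span {orderIdem k E R} : Ideal (PermutedOrderAlg k E))

/-- The element `f_R` of the fundamental module. -/
noncomputable def fundamentalGen (R : OrderOn E) : FundamentalModule k E R :=
  ⟨orderIdem k E R, Ideal.subset_span rfl⟩

/-- The fundamental functor `𝕊_{E,R} = L_{E,W} / J_{E,W}` for `W = 𝒫_E f_R`. -/
noncomputable def fundamentalFunctor (R : OrderOn E) : LinCorr.{u} k ⥤ ModuleCat.{max u v} k :=
  LJQuotient k E (FundamentalModule k E R)

instance (R : OrderOn E) : (fundamentalFunctor k E R).Additive :=
  inferInstanceAs (LJQuotient k E (FundamentalModule k E R)).Additive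

instance (R : OrderOn E) : (fundamentalFunctor k E R).Linear k :=
  inferInstanceAs ((LJQuotient k E (FundamentalModule k E R)).Linear k)

/-- The canonical isomorphism `𝒫_E f_R ≅ 𝕊_{E,R}(E)`. -/
noncomputable def fundamentalEval (R : OrderOn E) :
    FundamentalModule k E R ≃ₗ[k] (fundamentalFunctor k E R).obj (Free.of k E) :=
  evalEquiv k E (FundamentalModule k E R)

end Fundamental

/-! ### The functor associated to a finite lattice -/

section LatticeFunctor

variable (T : Type u) [Lattice T] [BoundedOrder T]

variable {T} in
/-- The action of a correspondence `R ⊆ Y × X` on maps `X → T`: `(R φ)(y)` is the join of the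
`φ x` with `(y, x) ∈ R`. -/
noncomputable def corrAct {X Y : FinCorr.{u}} (R : SetRel Y X) (φ : X → T) : Y → T :=
  fun y => (Set.toFinite {x : X | (y, x) ∈ R}).toFinset.sup φ

theorem corrAct_id (X : FinCorr.{u}) (φ : X → T) : corrAct (SetRel.id : SetRel X X) φ = φ := by
  funext y
  refine le_antisymm (Finset.sup_le fun x hx => ?_) (Finset.le_sup (f := φ) ?_)
  · have h : x = y := by simpa using hx
    rw [h]
  · simp

theorem corrAct_comp {X Y Z : FinCorr.{u}} (R : SetRel Y X) (S : SetRel Z Y) (φ : X → T) :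
    corrAct (SetRel.comp S R) φ = corrAct S (corrAct R φ) := by
  funext z
  refine le_antisymm (Finset.sup_le fun x hx => ?_) (Finset.sup_le fun y hy =>
    Finset.sup_le fun x hx => Finset.le_sup (f := φ) ?_)
  · obtain ⟨y, hy, hx⟩ : ∃ y, (z, y) ∈ S ∧ (y, x) ∈ R := by simpa using hx
    refine le_trans (Finset.le_sup (f := φ) (b := x) ?_)
      (Finset.le_sup (f := corrAct R φ) (b := y) ?_)
    · simpa using hx
    · simpa using hy
  · have hy' : (z, y) ∈ S := by simpa using hy
    have hx' : (y, x) ∈ R := by simpa using hx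
    have : (z, x) ∈ SetRel.comp S R := ⟨y, hy', hx'⟩
    simpa using this

variable (k : Type v) [CommRing k]

/-- The `k`-linear extension of the action of correspondences to `k𝒞(Y, X)`. -/
noncomputable def latticeMap (X Y : FinCorr.{u}) :
    ((Free.of k X : LinCorr.{u} k) ⟶ Free.of k Y) →ₗ[k] ((X → T) →₀ k) →ₗ[k] ((Y → T) →₀ k) :=
  Finsupp.linearCombination k fun R : SetRel Y X => Finsupp.lmapDomain k k (corrAct (T := T) R)

theorem latticeMap_relHom {X Y : FinCorr.{u}} (R : SetRel Y X) :
    latticeMap T k X Y (relHom k R) = Finsupp.lmapDomain k k (corrAct R) := by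
  refine (Finsupp.linearCombination_single k (1 : k) R).trans (one_smul k _)

theorem latticeMap_id (X : FinCorr.{u}) : latticeMap T k X X (𝟙 _) = LinearMap.id := by
  rw [← relHom_id, latticeMap_relHom]
  have : corrAct (T := T) (SetRel.id : SetRel X X) = id := funext (corrAct_id T X)
  rw [this, Finsupp.lmapDomain_id]

theorem latticeMap_comp {X Y Z : FinCorr.{u}} (f : (Free.of k X : LinCorr.{u} k) ⟶ Free.of k Y)
    (g : (Free.of k Y : LinCorr.{u} k) ⟶ Free.of k Z) :
    latticeMap T k X Z (f ≫ g) = latticeMap T k Y Z g ∘ₗ latticeMap T k X Y f := by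
  refine LinCorr.hom_induction k
    (P := fun f => latticeMap T k X Z (f ≫ g) = latticeMap T k Y Z g ∘ₗ latticeMap T k X Y f)
    f ?_ ?_ ?_
  · rw [Limits.zero_comp, map_zero, map_zero, LinearMap.comp_zero]
  · intro f f' h h'
    rw [Preadditive.add_comp, map_add, map_add, h, h', LinearMap.comp_add]
  intro c R
  refine LinCorr.hom_induction k
    (P := fun g => latticeMap T k X Z ((c • relHom k R) ≫ g) =
      latticeMap T k Y Z g ∘ₗ latticeMap T k X Y (c • relHom k R)) g ?_ ?_ ?_
  · rw [Limits.comp_zero, map_zero, map_zero, LinearMap.zero_comp]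
  · intro g g' h h'
    rw [Preadditive.comp_add, map_add, map_add, h, h', LinearMap.add_comp]
  intro d S
  rw [Linear.smul_comp, Linear.comp_smul, map_smul, map_smul, map_smul, map_smul,
    LinearMap.smul_comp, LinearMap.comp_smul, smul_comm]
  refine congrArg (fun z => d • c • z) ?_
  refine (congrArg _ (relHom_comp k R S)).trans ?_
  refine (latticeMap_relHom T k _).trans ?_
  refine Eq.trans ?_ (congrArg₂ LinearMap.comp (latticeMap_relHom T k S)
    (latticeMap_relHom T k R)).symm
  rw [← Finsupp.lmapDomain_comp]
  exact congrArg _ (funext fun φ => corrAct_comp T R S φ)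

/-- The correspondence functor `F_T`: its value at `X` is the free module with basis the set of
maps `X → T`. -/
noncomputable def latticeFunctor : LinCorr.{u} k ⥤ ModuleCat.{max u v} k where
  obj X := ModuleCat.of k ((X.toFin → T) →₀ k)
  map {X Y} f := ModuleCat.ofHom (latticeMap T k X.toFin Y.toFin f)
  map_id X := congrArg ModuleCat.ofHom (latticeMap_id T k X.toFin)
  map_comp {X Y Z} f g := congrArg ModuleCat.ofHom
    (latticeMap_comp T k (X := X.toFin) (Y := Y.toFin) (Z := Z.toFin) f g)

instance : (latticeFunctor T k).Additive where
  map_add {X Y f g} := congrArg ModuleCat.ofHom (map_add (latticeMap T k X.toFin Y.toFin) f g)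

instance : (latticeFunctor T k).Linear k where
  map_smul {X Y} f c := congrArg ModuleCat.ofHom (map_smul (latticeMap T k X.toFin Y.toFin) c f)

variable {T} in
/-- A map `φ : X → T`, as a basis element of `F_T(X)`. -/
noncomputable def latticeBasis {X : FinCorr.{u}} (φ : X → T) :
    (latticeFunctor T k).obj (Free.of k X) :=
  (Finsupp.single φ 1 : (X → T) →₀ k)

/-- The module `H_T(X)`, generated by the maps `φ : X → T` whose image does not contain all the
irreducible elements of `T`. -/
noncomputable def latticeHObj (X : FinCorr.{u}) : Submodule k ((X → T) →₀ k) :=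
  Submodule.span k {m | ∃ φ : X → T, ¬ {e : T | SupIrred e} ⊆ Set.range φ ∧
    m = Finsupp.single φ 1}

theorem latticeHObj_le {X Y : FinCorr.{u}} (f : (Free.of k X : LinCorr.{u} k) ⟶ Free.of k Y) :
    latticeHObj T k X ≤ (latticeHObj T k Y).comap (latticeMap T k X Y f) := by
  refine Submodule.span_le.2 ?_
  rintro _ ⟨φ, hφ, rfl⟩
  change latticeMap T k X Y f (Finsupp.single φ 1) ∈ latticeHObj T k Y
  refine LinCorr.hom_induction k
    (P := fun f => latticeMap T k X Y f (Finsupp.single φ 1) ∈ latticeHObj T k Y) f ?_ ?_ ?_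
  · rw [map_zero]
    exact Submodule.zero_mem _
  · intro f g hf hg
    rw [map_add]
    exact Submodule.add_mem _ hf hg
  · intro c R
    rw [map_smul]
    refine Submodule.smul_mem _ c (Submodule.subset_span ⟨corrAct R φ, fun h => hφ ?_, ?_⟩)
    · intro e he
      obtain ⟨y, hy⟩ := h he
      obtain ⟨x, -, hx⟩ := SupIrred.finset_sup_eq he hy
      exact ⟨x, hx⟩
    · rw [latticeMap_relHom, Finsupp.lmapDomain_apply, Finsupp.mapDomain_single]

/-- The subfunctor `H_T` of `F_T`. -/
noncomputable def latticeH : CorrSubfunctor (latticeFunctor T k) where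
  obj X := latticeHObj T k X.toFin
  map_le {X Y} f := latticeHObj_le T k (X := X.toFin) (Y := Y.toFin) f

variable [Finite T]

/-- The finite set `E` of irreducible elements of `T`. -/
def irrSet : FinCorr.{u} where
  carrier := {e : T // SupIrred e}

/-- The order `R` on the set `E` of irreducible elements of `T`, which makes it a full subposet
of `T`. -/
def irrOrder : OrderOn (irrSet T) :=
  ⟨{p | p.1.1 ≤ p.2.1}, fun a => le_refl a.1, fun _ _ h h' => Subtype.ext (le_antisymm h h'),
    fun _ _ _ h h' => le_trans (α := T) h h'⟩

/-- The inclusion `ι : E → T` of the irreducible elements. -/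
def irrIncl : irrSet T → T := Subtype.val

end LatticeFunctor

/-!
Let `f = f_{Rᵒᵖ}`. Each `φ : X → T` equals `A ι` for the relation `A = {(x, e) | e ≤ φ x}`, because
every element of `T` is a join of irreducible elements; hence `ι` generates `F_T`. By construction
an element of `L_{E,W} / J_{E,W}` vanishes as soon as all morphisms to `E` kill it. So `Θ_T` exists
provided that `a ι = 0` implies `a f = 0` for `a ∈ k𝒞(E, E)`, and `H_T` is in its kernel provided
that `H_T(E)` is.

Both follow from a computation in `𝒫_E`. If the relation `Q` contains no permutation, then `[Q] = 0`
by Hall's theorem. Otherwise `[Q] = [g] [S]` for a permutation `g` and a reflexive relation `S`, and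
`[S] = ∑_{U ⊇ S} f_U`, so that Möbius inversion gives `[S] f_R = f_R` if `S ⊆ R` and `[S] f_R = 0`
otherwise. For `Q` acting on `f`, the surviving case is exactly `Q ι = ι ∘ g`: hence `[Q] f` depends
only on `Q ι`, and it is zero unless `Q ι` takes every irreducible element as a value.
-/

section Generators

variable {k : Type v} [CommRing k] {C : Type*} [Category* C] {M M' : C ⥤ ModuleCat.{w} k} {E : C}

/-- An element `m ∈ M(E)` generates the functor `M` if the elements of `M(X)` are the images of `m`
under the morphisms `E ⟶ X`. No linear combinations are needed in the intended case, where `C` and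
`M` are `k`-linear. -/
def IsGenerator (M : C ⥤ ModuleCat.{w} k) {E : C} (m : M.obj E) : Prop :=
  ∀ X : C, Function.Surjective fun φ : E ⟶ X => (M.map φ).hom m

namespace IsGenerator

variable {m : M.obj E}

theorem hom_ext (hm : IsGenerator M m) {θ θ' : M ⟶ M'}
    (h : (θ.app E).hom m = (θ'.app E).hom m) : θ = θ' := by
  refine NatTrans.ext (funext fun X => ModuleCat.hom_ext (LinearMap.ext fun x => ?_))
  obtain ⟨φ, rfl⟩ := hm X x
  calc (θ.app X).hom ((M.map φ).hom m)
      = (M'.map φ).hom ((θ.app E).hom m) := NatTrans.naturality_apply θ φ m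
    _ = (M'.map φ).hom ((θ'.app E).hom m) := by rw [h]
    _ = (θ'.app X).hom ((M.map φ).hom m) := (NatTrans.naturality_apply θ' φ m).symm

theorem app_surjective {θ : M ⟶ M'} (h : IsGenerator M' ((θ.app E).hom m)) (X : C) :
    Function.Surjective (θ.app X).hom := by
  intro s
  obtain ⟨φ, rfl⟩ := h X s
  exact ⟨(M.map φ).hom m, NatTrans.naturality_apply θ φ m⟩

end IsGenerator

variable [Preadditive C] [Linear k C] [M.Additive] [M.Linear k] [M'.Additive] [M'.Linear k]

/-- The linear map `φ ↦ M(φ)(m)` that corresponds to `m ∈ M(E)` by the Yoneda lemma. -/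
def orbitMap (m : M.obj E) (X : C) : (E ⟶ X) →ₗ[k] M.obj X :=
  LinearMap.applyₗ m ∘ₗ ModuleCat.homLinearEquiv.toLinearMap ∘ₗ M.mapLinearMap k

theorem orbitMap_apply (m : M.obj E) {X : C} (φ : E ⟶ X) :
    orbitMap m X φ = (M.map φ).hom m := rfl

theorem orbitMap_comp (m : M.obj E) {X Y : C} (φ : E ⟶ X) (f : X ⟶ Y) :
    orbitMap m Y (φ ≫ f) = (M.map f).hom (orbitMap m X φ) := by
  simp only [orbitMap_apply, Functor.map_comp, ModuleCat.hom_comp, LinearMap.comp_apply]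

theorem isGenerator_iff_range_orbitMap_eq_top {m : M.obj E} :
    IsGenerator M m ↔ ∀ X : C, LinearMap.range (orbitMap m X) = ⊤ :=
  forall_congr' fun X => (LinearMap.range_eq_top (f := orbitMap m X)).symm

theorem IsGenerator.exists_hom {m : M.obj E} (hm : IsGenerator M m) (m' : M'.obj E)
    (h : ∀ (X : C) (φ : E ⟶ X), (M.map φ).hom m = 0 → (M'.map φ).hom m' = 0) :
    ∃ θ : M ⟶ M', (θ.app E).hom m = m' := by
  let θ (X : C) : M.obj X →ₗ[k] M'.obj X :=
    (LinearMap.ker (orbitMap m X)).liftQ (orbitMap m' X) (h X) ∘ₗ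
      ((orbitMap m X).quotKerEquivOfSurjective (hm X)).symm.toLinearMap
  have θ_orbitMap {X : C} (φ : E ⟶ X) : θ X (orbitMap m X φ) = orbitMap m' X φ :=
    congrArg ((LinearMap.ker (orbitMap m X)).liftQ (orbitMap m' X) (h X))
      ((orbitMap m X).quotKerEquivOfSurjective_symm_apply (hm X) φ)
  refine ⟨⟨fun X => ModuleCat.ofHom (θ X), fun X Y f => ?_⟩, ?_⟩
  · refine ModuleCat.hom_ext (LinearMap.ext fun x => ?_)
    obtain ⟨φ, rfl⟩ := hm X x
    change θ Y ((M.map f).hom (orbitMap m X φ)) = (M'.map f).hom (θ X (orbitMap m X φ))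
    rw [← orbitMap_comp, θ_orbitMap, θ_orbitMap, orbitMap_comp]
  · simpa [orbitMap_apply] using θ_orbitMap (𝟙 E)

end Generators

theorem LinCorr.linearMap_ext {k : Type v} [CommRing k] {X Y : FinCorr.{u}} {N : Type*}
    [AddCommMonoid N] [Module k N] {f g : ((Free.of k X : LinCorr.{u} k) ⟶ Free.of k Y) →ₗ[k] N}
    (h : ∀ R : SetRel Y X, f (relHom k R) = g (relHom k R)) : f = g :=
  LinearMap.ext fun φ => LinCorr.hom_induction k (P := fun φ => f φ = g φ) φ
    (by rw [map_zero, map_zero]) (fun φ ψ hφ hψ => by rw [map_add, map_add, hφ, hψ])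
    fun c R => by rw [map_smul, map_smul, h]

section Quotients

variable {k : Type v} [CommRing k] {M M' : LinCorr.{u} k ⥤ ModuleCat.{w} k}

namespace CorrSubfunctor

/-- The morphism `M / N ⟶ M'` induced by a morphism `M ⟶ M'` that vanishes on `N`. -/
noncomputable def desc (N : CorrSubfunctor M) (θ : M ⟶ M') (h : N ≤ ker θ) : N.quotient ⟶ M' where
  app X := ModuleCat.ofHom ((N.obj X).liftQ (θ.app X).hom (h X))
  naturality _ _ f := ModuleCat.hom_ext (Submodule.linearMap_qext _
    (LinearMap.ext fun m => NatTrans.naturality_apply θ f m))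

theorem proj_desc (N : CorrSubfunctor M) (θ : M ⟶ M') (h : N ≤ ker θ) :
    N.proj ≫ N.desc θ h = θ := rfl

theorem desc_app_surjective (N : CorrSubfunctor M) {θ : M ⟶ M'} (h : N ≤ ker θ)
    {X : LinCorr.{u} k} (hθ : Function.Surjective (θ.app X).hom) :
    Function.Surjective ((N.desc θ h).app X).hom := by
  intro s
  obtain ⟨m, rfl⟩ := hθ s
  exact ⟨(N.obj X).mkQ m, rfl⟩

theorem quotient_hom_ext {N : CorrSubfunctor M} {θ θ' : N.quotient ⟶ M'}
    (h : N.proj ≫ θ = N.proj ≫ θ') : θ = θ' :=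
  NatTrans.ext (funext fun X => ModuleCat.hom_ext (Submodule.linearMap_qext _
    (LinearMap.ext fun m => ConcreteCategory.congr_hom (NatTrans.congr_app h X) m)))

end CorrSubfunctor

end Quotients

section LJQuotient

variable {k : Type v} [CommRing k] {E : FinCorr.{u}} {W : Type (max u v)} [AddCommGroup W]
  [Module k W] [Module (RelAlg k E) W] [IsScalarTower k (RelAlg k E) W]
  {M : LinCorr.{u} k ⥤ ModuleCat.{max u v} k}

theorem isGenerator_evalEquiv {x : W} (hx : ∀ y : W, ∃ a : RelAlg k E, a • x = y) :
    IsGenerator (LJQuotient k E W) (evalEquiv k E W x) := by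
  refine isGenerator_iff_range_orbitMap_eq_top.2 fun X => eq_top_iff.2 fun s _ => ?_
  let q : (Free.of k E ⟶ X) ⊗[k] W →ₗ[k] (LJQuotient k E W).obj X :=
    ((JSubfunctor k E W).obj X).mkQ ∘ₗ (balancedRel k E W X).mkQ
  suffices ∀ t, q t ∈ LinearMap.range (orbitMap (evalEquiv k E W x) X) by
    obtain ⟨l, rfl⟩ := Submodule.mkQ_surjective _ s
    obtain ⟨t, rfl⟩ := Submodule.mkQ_surjective _ l
    exact this t
  intro t
  induction t with
  | zero => exact (map_zero q).symm ▸ Submodule.zero_mem _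
  | add t t' ht ht' => exact (map_add q t t').symm ▸ Submodule.add_mem _ ht ht'
  | tmul φ y =>
    obtain ⟨a, rfl⟩ := hx y
    refine ⟨a.asHom ≫ φ, ?_⟩
    change ((JSubfunctor k E W).obj X).mkQ (ltmul E W (𝟙 (Free.of k E) ≫ a.asHom ≫ φ) x) =
      ((JSubfunctor k E W).obj X).mkQ (ltmul E W φ (a • x))
    rw [Category.id_comp, ltmul_comp]

theorem LJQuotient_eq_zero {X : LinCorr.{u} k} {s : (LJQuotient k E W).obj X}
    (h : ∀ ψ : X ⟶ Free.of k E, ((LJQuotient k E W).map ψ).hom s = 0) : s = 0 := by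
  obtain ⟨l, rfl⟩ := Submodule.mkQ_surjective _ s
  refine (Submodule.Quotient.mk_eq_zero _).2 ((Submodule.mem_iInf _).2 fun ψ => ?_)
  have map_mem : ((LFunctor k E W).map ψ).hom l ∈ (JSubfunctor k E W).obj (Free.of k E) :=
    (Submodule.Quotient.mk_eq_zero _).1 (h ψ)
  have LPairing_id : LPairing E W (𝟙 _) ∘ₗ ((LFunctor k E W).map ψ).hom = LPairing E W ψ :=
    LFunctor_hom_ext fun φ x => by
      rw [LinearMap.comp_apply, LFunctor_map_ltmul, LPairing_ltmul, LPairing_ltmul,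
        Category.comp_id]
  rw [← LPairing_id]
  exact (Submodule.mem_iInf _).1 map_mem (𝟙 _)

theorem IsGenerator.exists_hom_LJQuotient [M.Additive] [M.Linear k] {m : M.obj (Free.of k E)}
    (hm : IsGenerator M m) (x : W)
    (h : ∀ a : RelAlg k E, (M.map a.asHom).hom m = 0 → a • x = 0) :
    ∃ θ : M ⟶ LJQuotient k E W, (θ.app (Free.of k E)).hom m = evalEquiv k E W x := by
  refine hm.exists_hom _ fun X φ hφ => LJQuotient_eq_zero fun ψ => ?_
  have comp_smul : (End.of (φ ≫ ψ) : RelAlg k E) • x = 0 := by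
    refine h _ ?_
    change orbitMap m _ (φ ≫ ψ) = 0
    rw [orbitMap_comp, orbitMap_apply, hφ, map_zero]
  change ((LJQuotient k E W).map ψ).hom (orbitMap (evalEquiv k E W x) X φ) = 0
  rw [← orbitMap_comp, orbitMap_apply]
  exact (evalEquiv_smul k E W (End.of (φ ≫ ψ)) x).symm.trans (by rw [comp_smul, map_zero])

theorem CorrSubfunctor.le_ker_of_eval_le (N : CorrSubfunctor M) (θ : M ⟶ LJQuotient k E W)
    (h : N.obj (Free.of k E) ≤ LinearMap.ker (θ.app (Free.of k E)).hom) : N ≤ ker θ :=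
  fun _ m hm => LJQuotient_eq_zero fun ψ =>
    (NatTrans.naturality_apply θ ψ m).symm.trans (h (N.map_le ψ hm))

end LJQuotient

section Inessential

variable {E : FinCorr.{u}}

theorem Inessential.of_ncard_image_lt {Q : SetRel E E} {s : Set E}
    (h : (Q.image s).ncard < s.ncard) : Inessential Q := by
  refine ⟨⟨↥sᶜ ⊕ Q.image s⟩,
    {p | p.2.elim (fun y => p.1 = y.1) (fun y => p.1 ∈ s ∧ (p.1, y.1) ∈ Q)},
    {p | p.1.elim (fun y => (y.1, p.2) ∈ Q) (fun y => y.1 = p.2)}, ?_, ?_⟩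
  · have card_compl := Set.ncard_add_ncard_compl s
    change Nat.card (↥sᶜ ⊕ Q.image s) < Nat.card E
    rw [Nat.card_sum, Nat.card_coe_set_eq, Nat.card_coe_set_eq]
    omega
  · ext ⟨a, b⟩
    constructor
    · intro hab
      by_cases ha : a ∈ s
      · exact ⟨Sum.inr ⟨b, a, ha, hab⟩, ⟨ha, hab⟩, rfl⟩
      · exact ⟨Sum.inl ⟨a, ha⟩, rfl, hab⟩
    · rintro ⟨⟨y, hy⟩ | ⟨y, hy⟩, hay, hyb⟩
      · obtain rfl : a = y := hay
        exact hyb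
      · obtain rfl : y = b := hyb
        exact hay.2

theorem exists_perm_of_not_inessential {Q : SetRel E E} (hQ : ¬ Inessential Q) :
    ∃ g : Equiv.Perm E, ∀ e, (e, g e) ∈ Q := by
  classical
  have := Fintype.ofFinite E
  have hall (A : Finset E) : A.card ≤ Fintype.card (Q.image A) := by
    rw [← Nat.card_eq_fintype_card, Nat.card_coe_set_eq, ← Set.ncard_coe_finset]
    exact not_lt.1 fun h => hQ (.of_ncard_image_lt h)
  obtain ⟨g, g_inj, hg⟩ := (Fintype.all_card_le_rel_image_card_iff_exists_injective Q).1 hall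
  exact ⟨Equiv.ofBijective g (Finite.injective_iff_bijective.1 g_inj), hg⟩

theorem Inessential.of_not_antisymm {Q : SetRel E E} (hrefl : ∀ a, (a, a) ∈ Q)
    (htrans : ∀ a b c, (a, b) ∈ Q → (b, c) ∈ Q → (a, c) ∈ Q) {a b : E}
    (hab : (a, b) ∈ Q) (hba : (b, a) ∈ Q) (hne : a ≠ b) : Inessential Q := by
  refine ⟨⟨{x : E // x ≠ b}⟩, {p | (p.1, p.2.1) ∈ Q}, {p | (p.1.1, p.2) ∈ Q},
    Finite.card_subtype_lt (x := b) (not_not.2 rfl), ?_⟩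
  ext ⟨x, z⟩
  constructor
  · intro hxz
    by_cases hx : x = b
    · subst hx
      exact ⟨⟨a, hne⟩, hba, htrans _ _ _ hab hxz⟩
    · exact ⟨⟨x, hx⟩, hrefl x, hxz⟩
  · rintro ⟨y, hxy, hyz⟩
    exact htrans _ _ _ hxy hyz

end Inessential

namespace OrderOn

variable {E : Type u}

theorem transClosure_subset_iff (U : OrderOn E) {S : SetRel E E} :
    S.transClosure ⊆ U.1 ↔ S ⊆ U.1 := by
  refine ⟨fun h p hp => h (Relation.TransGen.single hp), ?_⟩
  rintro h ⟨a, b⟩ hab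
  change Relation.TransGen _ a b at hab
  induction hab with
  | single hab => exact h hab
  | tail _ hbc ih => exact U.2.2.2 _ _ _ ih (h hbc)

theorem comp_subset_iff (U : OrderOn E) {R S : SetRel E E} (hR : ∀ a, (a, a) ∈ R)
    (hS : ∀ a, (a, a) ∈ S) : SetRel.comp R S ⊆ U.1 ↔ R ⊆ U.1 ∧ S ⊆ U.1 := by
  constructor
  · exact fun h => ⟨fun p hp => h ⟨p.2, hp, hS _⟩, fun p hp => h ⟨p.1, hR _, hp⟩⟩
  · rintro ⟨hRU, hSU⟩ _ ⟨b, hab, hbc⟩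
    exact U.2.2.2 _ _ _ (hRU hab) (hSU hbc)

variable [Finite E]

theorem moebius_eq_zero {R S : OrderOn E} (h : ¬ R ≤ S) : R.moebius S = 0 :=
  IncidenceAlgebra.apply_eq_zero_of_not_le h _

open Classical in
theorem sum_moebius_left (R S : OrderOn E) :
    ∑ U : OrderOn E with R ≤ U, U.moebius S = if R = S then 1 else 0 := by
  rw [← IncidenceAlgebra.sum_Icc_mu_left R S]
  refine (Finset.sum_subset (fun U hU => ?_) fun U hRU hU => moebius_eq_zero fun hUS => ?_).symm
  · simpa using (Finset.mem_Icc.1 hU).1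
  · exact hU (Finset.mem_Icc.2 ⟨(Finset.mem_filter.1 hRU).2, hUS⟩)

open Classical in
theorem sum_moebius_right (R S : OrderOn E) :
    ∑ U : OrderOn E with U ≤ S, R.moebius U = if R = S then 1 else 0 := by
  rw [← IncidenceAlgebra.sum_Icc_mu_right R S]
  refine (Finset.sum_subset (fun U hU => ?_) fun U hUS hU => moebius_eq_zero fun hRU => ?_).symm
  · simpa using (Finset.mem_Icc.1 hU).2
  · exact hU (Finset.mem_Icc.2 ⟨hRU, (Finset.mem_filter.1 hUS).2⟩)

end OrderOn

section OrderIdem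

variable (k : Type v) [CommRing k] {E : FinCorr.{u}}

/-- The class `[Q]` of a relation `Q` in the algebra `𝒫_E` of permuted orders. -/
noncomputable def relClass (Q : SetRel E E) : PermutedOrderAlg k E :=
  PermutedOrderAlg.mk k E (End.of (relHom k Q))

theorem relClass_comp (A B : SetRel E E) :
    relClass k (SetRel.comp A B) = relClass k A * relClass k B := by
  unfold relClass
  rw [← map_mul, ← relHom_comp]
  rfl

theorem relClass_eq_zero {Q : SetRel E E} (h : Inessential Q) : relClass k Q = 0 :=
  (RingQuot.mkAlgHom_rel k (PermutedOrderRel.inessential Q h)).trans (map_zero _)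

theorem relClass_transClosure {S : SetRel E E} (h : ∀ a, (a, a) ∈ S) :
    relClass k S.transClosure = relClass k S :=
  (RingQuot.mkAlgHom_rel k (PermutedOrderRel.closure S h)).symm

open Classical in
theorem relClass_order (R : OrderOn E) :
    relClass k R.1 = ∑ U : OrderOn E with R ≤ U, orderIdem k E U := by
  unfold orderIdem
  rw [Finset.sum_comm]
  simp_rw [← Finset.sum_smul, OrderOn.sum_moebius_left, ite_smul, one_smul, zero_smul]
  rw [Finset.sum_ite_eq, if_pos (Finset.mem_univ _), relClass]

open Classical in
theorem relClass_of_refl {S : SetRel E E} (hS : ∀ a, (a, a) ∈ S) :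
    relClass k S = ∑ U : OrderOn E with S ⊆ U.1, orderIdem k E U := by
  have hrefl (a : E) : (a, a) ∈ S.transClosure := Relation.TransGen.single (hS a)
  have htrans (a b c : E) : (a, b) ∈ S.transClosure → (b, c) ∈ S.transClosure →
      (a, c) ∈ S.transClosure := Relation.TransGen.trans
  have subset_iff (U : OrderOn E) : S ⊆ U.1 ↔ S.transClosure ⊆ U.1 :=
    U.transClosure_subset_iff.symm
  simp_rw [subset_iff]
  rw [← relClass_transClosure k hS]
  by_cases hanti : ∀ a b, (a, b) ∈ S.transClosure → (b, a) ∈ S.transClosure → a = b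
  · exact relClass_order k ⟨S.transClosure, hrefl, hanti, htrans⟩
  · push Not at hanti
    obtain ⟨a, b, hab, hba, hne⟩ := hanti
    rw [relClass_eq_zero k (.of_not_antisymm hrefl htrans hab hba hne), Finset.sum_filter]
    exact (Finset.sum_eq_zero fun U _ => if_neg fun hU =>
      hne (U.2.2.1 a b (hU hab) (hU hba))).symm

open Classical in
theorem relClass_mul_relClass_order {S : SetRel E E} (hS : ∀ a, (a, a) ∈ S) (R : OrderOn E) :
    relClass k S * relClass k R.1 =
      ∑ U : OrderOn E with S ⊆ U.1 ∧ R ≤ U, orderIdem k E U := by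
  rw [← relClass_comp, relClass_of_refl k (S := SetRel.comp S R.1) fun a => ⟨a, hS a, R.2.1 a⟩]
  simp_rw [OrderOn.comp_subset_iff _ hS R.2.1]
  rfl

open Classical in
theorem relClass_mul_orderIdem {S : SetRel E E} (hS : ∀ a, (a, a) ∈ S) (R : OrderOn E) :
    relClass k S * orderIdem k E R = if S ⊆ R.1 then orderIdem k E R else 0 := by
  calc relClass k S * orderIdem k E R
      = ∑ V : OrderOn E, R.moebius V • (relClass k S * relClass k V.1) := by
        simp_rw [orderIdem, Finset.mul_sum, mul_smul_comm]
        rfl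
    _ = ∑ U : OrderOn E with S ⊆ U.1, (∑ V : OrderOn E with V ≤ U, R.moebius V) •
          orderIdem k E U := by
        simp_rw [relClass_mul_relClass_order k hS, Finset.smul_sum, Finset.sum_smul]
        refine Finset.sum_comm' fun V U => ?_
        simp only [Finset.mem_univ, Finset.mem_filter, true_and]
        exact and_comm
    _ = ∑ U : OrderOn E with S ⊆ U.1, if R = U then orderIdem k E U else 0 := by
        simp_rw [OrderOn.sum_moebius_right, ite_smul, one_smul, zero_smul]
    _ = if S ⊆ R.1 then orderIdem k E R else 0 := by
        simp only [Finset.sum_ite_eq, Finset.mem_filter, Finset.mem_univ, true_and]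

open Classical in
theorem relClass_mul_orderIdem_of_perm (R : OrderOn E) {Q : SetRel E E} (g : Equiv.Perm E)
    (hg : ∀ e, (e, g e) ∈ Q) :
    relClass k Q * orderIdem k E R = if ∀ e x, (e, x) ∈ Q → (g e, x) ∈ R.1 then
      relClass k (Function.graph g) * orderIdem k E R else 0 := by
  let S : SetRel E E := SetRel.comp (Function.graph g).inv Q
  have hS (a : E) : (a, a) ∈ S := ⟨g.symm a, g.apply_symm_apply a, by simpa using hg (g.symm a)⟩
  have hQ : SetRel.comp (Function.graph g) S = Q := by
    ext ⟨a, b⟩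
    constructor
    · rintro ⟨c, hc, e, he, heb⟩
      obtain rfl : g a = c := hc
      obtain rfl : e = a := g.injective he
      exact heb
    · exact fun hab => ⟨g a, rfl, a, rfl, hab⟩
  have hSR : S ⊆ R.1 ↔ ∀ e x, (e, x) ∈ Q → (g e, x) ∈ R.1 := by
    constructor
    · exact fun h e x hex => h ⟨e, rfl, hex⟩
    · rintro h ⟨y, x⟩ ⟨e, he, hex⟩
      obtain rfl : g e = y := he
      exact h e x hex
  nth_rw 1 [← hQ]
  rw [relClass_comp, mul_assoc, relClass_mul_orderIdem k hS, mul_ite, mul_zero]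
  simp only [hSR]

theorem exists_smul_fundamentalGen_eq {R : OrderOn E} (x : FundamentalModule k E R) :
    ∃ a : RelAlg k E, a • fundamentalGen k E R = x := by
  obtain ⟨p, hp⟩ := Ideal.mem_span_singleton'.1 x.2
  obtain ⟨a, rfl⟩ := RingQuot.mkAlgHom_surjective k (PermutedOrderRel k E) p
  exact ⟨a, Subtype.ext hp⟩

end OrderIdem

section CorrAct

variable {T : Type u} [Lattice T] [BoundedOrder T] {X Y : FinCorr.{u}} {S : SetRel Y X}

theorem le_corrAct (φ : X → T) {y : Y} {x : X} (h : (y, x) ∈ S) : φ x ≤ corrAct S φ y :=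
  Finset.le_sup (f := φ) (by simpa using h)

theorem corrAct_le {φ : X → T} {y : Y} {t : T} (h : ∀ x, (y, x) ∈ S → φ x ≤ t) :
    corrAct S φ y ≤ t :=
  Finset.sup_le fun x hx => h x (by simpa using hx)

theorem exists_eq_of_corrAct_eq {φ : X → T} {y : Y} {t : T} (ht : SupIrred t)
    (h : corrAct S φ y = t) : ∃ x, (y, x) ∈ S ∧ φ x = t := by
  obtain ⟨x, hx, hxt⟩ := ht.finset_sup_eq h
  exact ⟨x, by simpa using hx, hxt⟩

variable [Finite T]

/-- The relation `{(x, e) | e ≤ φ x}` between `X` and the set `E` of irreducible elements of `T`: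
the largest relation that carries `ι : E → T` to `φ : X → T`. -/
def lowerRel (φ : X → T) : SetRel X (irrSet T) := {p | p.2.1 ≤ φ p.1}

theorem corrAct_lowerRel (φ : X → T) : corrAct (lowerRel φ) (irrIncl T) = φ := by
  funext x
  refine le_antisymm (corrAct_le fun e he => he) ?_
  obtain ⟨s, hs, hirr⟩ := exists_supIrred_decomposition (φ x)
  rw [← hs]
  refine Finset.sup_le fun t ht => ?_
  refine le_corrAct (irrIncl T) (x := (⟨t, hirr ht⟩ : irrSet T)) ?_
  exact (Finset.le_sup (f := id) ht).trans hs.le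

theorem corrAct_irrIncl_eq_iff (Q : SetRel (irrSet T) (irrSet T))
    (g : Equiv.Perm (irrSet T)) :
    corrAct Q (irrIncl T) = irrIncl T ∘ g ↔
      (∀ e, (e, g e) ∈ Q) ∧ ∀ e x, (e, x) ∈ Q → (g e, x) ∈ (irrOrder T).op.1 := by
  constructor
  · intro h
    refine ⟨fun e => ?_, fun e x hex => ?_⟩
    · obtain ⟨x, hx, hxe⟩ := exists_eq_of_corrAct_eq (g e).2 (congrFun h e)
      rwa [Subtype.ext hxe] at hx
    · exact (le_corrAct (irrIncl T) hex).trans (congrFun h e).le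
  · rintro ⟨hg, hQ⟩
    funext e
    exact le_antisymm (corrAct_le fun x hx => hQ e x hx) (le_corrAct (irrIncl T) (hg e))

variable (k : Type v) [CommRing k] {Q Q' : SetRel (irrSet T) (irrSet T)}

theorem relClass_mul_orderIdem_irrOrder_of_eq_comp {g : Equiv.Perm (irrSet T)}
    (h : corrAct Q (irrIncl T) = irrIncl T ∘ g) :
    relClass k Q * orderIdem k (irrSet T) (irrOrder T).op =
      relClass k (Function.graph g) * orderIdem k (irrSet T) (irrOrder T).op := by
  obtain ⟨hg, hQ⟩ := (corrAct_irrIncl_eq_iff Q g).1 h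
  rw [relClass_mul_orderIdem_of_perm k _ g hg, if_pos hQ]

theorem relClass_mul_orderIdem_irrOrder_eq_zero
    (h : ∀ g : Equiv.Perm (irrSet T), corrAct Q (irrIncl T) ≠ irrIncl T ∘ g) :
    relClass k Q * orderIdem k (irrSet T) (irrOrder T).op = 0 := by
  by_cases hQ : Inessential Q
  · rw [relClass_eq_zero k hQ, zero_mul]
  · obtain ⟨g, hg⟩ := exists_perm_of_not_inessential hQ
    rw [relClass_mul_orderIdem_of_perm k _ g hg,
      if_neg fun hQR => h g ((corrAct_irrIncl_eq_iff Q g).2 ⟨hg, hQR⟩)]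

theorem relClass_mul_orderIdem_irrOrder_congr
    (h : corrAct Q (irrIncl T) = corrAct Q' (irrIncl T)) :
    relClass k Q * orderIdem k (irrSet T) (irrOrder T).op =
      relClass k Q' * orderIdem k (irrSet T) (irrOrder T).op := by
  by_cases hQ : ∃ g : Equiv.Perm (irrSet T), corrAct Q (irrIncl T) = irrIncl T ∘ g
  · obtain ⟨g, hg⟩ := hQ
    rw [relClass_mul_orderIdem_irrOrder_of_eq_comp k hg,
      relClass_mul_orderIdem_irrOrder_of_eq_comp k (h.symm.trans hg)]
  · push Not at hQ
    rw [relClass_mul_orderIdem_irrOrder_eq_zero k hQ,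
      relClass_mul_orderIdem_irrOrder_eq_zero k (h ▸ hQ)]

end CorrAct

section LatticeFunctor

variable (k : Type v) [CommRing k] {T : Type u} [Lattice T] [BoundedOrder T]

theorem latticeFunctor_map_relHom {X Y : FinCorr.{u}} (S : SetRel Y X) (φ : X → T) :
    ((latticeFunctor T k).map (relHom k S)).hom (latticeBasis k φ) =
      latticeBasis k (corrAct S φ) :=
  (congrArg (fun f => f (Finsupp.single φ 1)) (latticeMap_relHom T k S)).trans
    Finsupp.mapDomain_single

variable [Finite T]

theorem latticeFunctor_map_lowerRel {X : FinCorr.{u}} (φ : X → T) :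
    ((latticeFunctor T k).map (relHom k (lowerRel φ))).hom (latticeBasis k (irrIncl T)) =
      latticeBasis k φ := by
  rw [latticeFunctor_map_relHom, corrAct_lowerRel]

variable (T) in
theorem isGenerator_irrIncl : IsGenerator (latticeFunctor T k) (latticeBasis k (irrIncl T)) := by
  refine isGenerator_iff_range_orbitMap_eq_top.2 fun X => eq_top_iff.2 fun x _ => ?_
  refine Finsupp.induction_linear (motive := fun x : (X.toFin → T) →₀ k =>
    x ∈ LinearMap.range (orbitMap (latticeBasis k (irrIncl T)) X)) x
    (Submodule.zero_mem _) (fun _ _ => Submodule.add_mem _) fun φ c => ?_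
  rw [← Finsupp.smul_single_one]
  exact Submodule.smul_mem _ c ⟨relHom k (lowerRel φ), latticeFunctor_map_lowerRel k φ⟩

variable (T) in
/-- The linear map `F_T(E) → 𝒫_E` through which the action of `k𝒞(E, E)` on `f_{Rᵒᵖ}` factors: it
sends `Q ι` to `[Q] f_{Rᵒᵖ}`, where `Q` is chosen to be the largest relation with a given `Q ι`. -/
noncomputable def irrAction :
    (latticeFunctor T k).obj (Free.of k (irrSet T)) →ₗ[k] PermutedOrderAlg k (irrSet T) :=
  Finsupp.linearCombination k fun φ : irrSet T → T =>
    relClass k (lowerRel φ) * orderIdem k (irrSet T) (irrOrder T).op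

theorem irrAction_latticeBasis (φ : irrSet T → T) :
    irrAction k T (latticeBasis k φ) =
      relClass k (lowerRel φ) * orderIdem k (irrSet T) (irrOrder T).op :=
  (Finsupp.linearCombination_single k (1 : k) φ).trans (one_smul k _)

theorem irrAction_map (a : RelAlg k (irrSet T)) :
    irrAction k T (((latticeFunctor T k).map a.asHom).hom (latticeBasis k (irrIncl T))) =
      PermutedOrderAlg.mk k (irrSet T) a * orderIdem k (irrSet T) (irrOrder T).op := by
  suffices irrAction k T ∘ₗ orbitMap (latticeBasis k (irrIncl T)) (Free.of k (irrSet T)) =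
      LinearMap.mulRight k (orderIdem k (irrSet T) (irrOrder T).op) ∘ₗ
        (PermutedOrderAlg.mk k (irrSet T)).toLinearMap from LinearMap.congr_fun this a
  refine LinCorr.linearMap_ext fun Q => ?_
  rw [LinearMap.comp_apply, orbitMap_apply, latticeFunctor_map_relHom, irrAction_latticeBasis]
  exact relClass_mul_orderIdem_irrOrder_congr k (corrAct_lowerRel _)

theorem smul_fundamentalGen_eq_zero {a : RelAlg k (irrSet T)}
    (h : ((latticeFunctor T k).map a.asHom).hom (latticeBasis k (irrIncl T)) = 0) :
    a • fundamentalGen k (irrSet T) (irrOrder T).op = 0 :=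
  Subtype.ext ((irrAction_map k a).symm.trans (by rw [h, map_zero]; rfl))

theorem relClass_lowerRel_mul_orderIdem_eq_zero {φ : irrSet T → T}
    (hφ : ¬ {e : T | SupIrred e} ⊆ Set.range φ) :
    relClass k (lowerRel φ) * orderIdem k (irrSet T) (irrOrder T).op = 0 := by
  refine relClass_mul_orderIdem_irrOrder_eq_zero k fun g hg => hφ fun t ht => ?_
  rw [corrAct_lowerRel] at hg
  obtain ⟨e, he⟩ := g.surjective (⟨t, ht⟩ : {e : T // SupIrred e})
  exact ⟨e, (congrFun hg e).trans (congrArg Subtype.val he)⟩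

theorem latticeH_le_ker {Θ : latticeFunctor T k ⟶ fundamentalFunctor k (irrSet T) (irrOrder T).op}
    (hΘ : (Θ.app (Free.of k (irrSet T))).hom (latticeBasis k (irrIncl T)) =
      fundamentalEval k (irrSet T) (irrOrder T).op
        (fundamentalGen k (irrSet T) (irrOrder T).op)) :
    latticeH T k ≤ CorrSubfunctor.ker Θ := by
  refine (latticeH T k).le_ker_of_eval_le Θ (Submodule.span_le.2 ?_)
  rintro _ ⟨(φ : irrSet T → T), hφ, rfl⟩
  let a : RelAlg k (irrSet T) := End.of (relHom k (lowerRel φ))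
  have smul_gen : a • fundamentalGen k (irrSet T) (irrOrder T).op = 0 :=
    Subtype.ext (relClass_lowerRel_mul_orderIdem_eq_zero k hφ)
  change (Θ.app (Free.of k (irrSet T))).hom (latticeBasis k φ) = 0
  calc (Θ.app (Free.of k (irrSet T))).hom (latticeBasis k φ)
      = ((fundamentalFunctor k (irrSet T) (irrOrder T).op).map a.asHom).hom
          ((Θ.app (Free.of k (irrSet T))).hom (latticeBasis k (irrIncl T))) := by
        rw [← latticeFunctor_map_lowerRel k φ]
        exact NatTrans.naturality_apply Θ (relHom k (lowerRel φ)) _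
    _ = fundamentalEval k (irrSet T) (irrOrder T).op
          (a • fundamentalGen k (irrSet T) (irrOrder T).op) := by
        rw [hΘ]
        exact (evalEquiv_smul k (irrSet T) _ a _).symm
    _ = 0 := by rw [smul_gen, map_zero]

end LatticeFunctor

theorem mainTheorem3 (k : Type v) [CommRing k] (T : Type u) [Lattice T] [BoundedOrder T]
    [Finite T] :
    ∃ Θ : latticeFunctor T k ⟶ fundamentalFunctor k (irrSet T) (irrOrder T).op,
      ((Θ.app (Free.of k (irrSet T))).hom (latticeBasis k (irrIncl T)) =
          fundamentalEval k (irrSet T) (irrOrder T).op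
            (fundamentalGen k (irrSet T) (irrOrder T).op) ∧
        ∀ Θ' : latticeFunctor T k ⟶ fundamentalFunctor k (irrSet T) (irrOrder T).op,
          (Θ'.app (Free.of k (irrSet T))).hom (latticeBasis k (irrIncl T)) =
            fundamentalEval k (irrSet T) (irrOrder T).op
              (fundamentalGen k (irrSet T) (irrOrder T).op) → Θ' = Θ) ∧
      (∀ X : LinCorr.{u} k, Function.Surjective (Θ.app X).hom) ∧
      latticeH T k ≤ CorrSubfunctor.ker Θ ∧
      ∃ Θbar : (latticeH T k).quotient ⟶ fundamentalFunctor k (irrSet T) (irrOrder T).op,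
        ((latticeH T k).proj ≫ Θbar = Θ ∧
          ∀ Θbar' : (latticeH T k).quotient ⟶ fundamentalFunctor k (irrSet T) (irrOrder T).op,
            (latticeH T k).proj ≫ Θbar' = Θ → Θbar' = Θbar) ∧
        ∀ X : LinCorr.{u} k, Function.Surjective (Θbar.app X).hom := by
  obtain ⟨Θ, hΘ⟩ := (isGenerator_irrIncl k T).exists_hom_LJQuotient
    (fundamentalGen k (irrSet T) (irrOrder T).op) fun _ => smul_fundamentalGen_eq_zero k
  have hgen := isGenerator_evalEquiv (exists_smul_fundamentalGen_eq k (R := (irrOrder T).op))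
  have hsurj (X : LinCorr.{u} k) : Function.Surjective (Θ.app X).hom :=
    IsGenerator.app_surjective (hΘ.symm ▸ hgen) X
  have hker : latticeH T k ≤ CorrSubfunctor.ker Θ := latticeH_le_ker k hΘ
  refine ⟨Θ, ⟨hΘ, fun Θ' hΘ' => (isGenerator_irrIncl k T).hom_ext (hΘ'.trans hΘ.symm)⟩, hsurj,
    hker, (latticeH T k).desc Θ hker, ⟨CorrSubfunctor.proj_desc _ Θ hker, ?_⟩, ?_⟩
  · exact fun _ h => CorrSubfunctor.quotient_hom_ext h
  · exact fun X => CorrSubfunctor.desc_app_surjective _ hker (hsurj X)
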